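/- **Definitions.** For a regular cardinal $\chi$, $\mathcal H(\chi)$ is the set of all sets whose transitive closure has cardinality less than $\chi$. For a cardinal $\kappa$, $J^{\rm bd}_\kappa$ is the ideal of bounded subsets of $\kappa$. For an ideal $J$ on $\kappa$ and $f,g\in\prod_{i<\kappa}\lambda_i$ write $f<_Jg$ if $\{i<\kappa: g(i)\le f(i)\}\in J$; ${\rm tcf}(\prod_{i<\kappa}\lambda_i,J)=\theta$ means that there is a $<_J$-increasing sequence that is cofinal in the product, and that $\theta$ is the least length of such a sequence. Let $\mu$ be a singular cardinal, $\kappa=\mathrm{cf}(\mu)$, $\chi>2^\mu$ regular, and let $\mathfrak H$ be the structure $(\mathcal H(\chi),\in)$, possibly augmented by finitely many additional predicates. A matrix $\langle M_{\alpha i}:\alpha<\lambda,\ i<\kappa\rangle$ of elementary submodels of $\mathfrak H$ *satisfies the array clauses* for a sequence of cardinals $\bar\lambda=\langle\lambda_i:i<\kappa\rangle$ and an ideal $J$ on $\kappa$ if 1. $M_{\alpha i}\prec M_{\alpha j}$ for all $\alpha<\lambda$ and $i<j<\kappa$; 2. for all $\alpha<\beta<\lambda$ there is $u\in J$ such that $M_{\alpha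 j}\prec M_{\beta j}$ for every $j\in\kappa\setminus u$; 3. $|M_{\alpha i}|<\lambda_i$ for all $\alpha<\lambda$, $i<\kappa$. It is a $\lambda\times\kappa$ *pcf array* based on $\bar\lambda$ and $J$ if moreover $\bar\lambda$ is a strictly increasing sequence of regular cardinals with $\mu=\bigcup_{i<\kappa}\lambda_i$, $J$ is a proper ideal that includes $J^{\rm bd}_\kappa$, $\mu<\lambda$, and ${\rm tcf}(\prod_{i<\kappa}\lambda_i,J)$ exists and is greater than $\lambda$. **Claim.** Let $\mu$ be a strong limit singular cardinal with $\kappa=\mathrm{cf}(\mu)>\omega$. Let $\chi>2^\mu$ be a regular cardinal, and let $\mathfrak H$ be $(\mathcal H(\chi),\in)$, possibly augmented by finitely many additional predicates. Let $\bar\mu=\langle\mu_i:i<\kappa\rangle$ be a strictly increasing continuous sequence of cardinals with $\mu=\bigcup_{i<\kappa}\mu_i$ and $\mu_0>\kappa$, and let $\bar\lambda=\langle\lambda_i:i<\kappa\rangle$ be a strictly increasing sequence of cardinals with $\mu=\bigcup_{i<\kappa}\lambda_i$. Then there is a strictly increasing $h:\kappa\to\kappa$ such that $2^{(\mu_i^+)}<\lambda_{h(i)}$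 for every $i<\kappa$. For every such $h$ (in particular for the identity, if $2^{(\mu_i^+)}<\lambda_i$ for every $i<\kappa$) there is a matrix $\mathcal M=\langle M_{\alpha i}:\alpha<\mu^+,\ i<\kappa\rangle$ of elementary submodels of $\mathfrak H$ such that * $\mathcal M$ satisfies the array clauses for $\langle\lambda_{h(i)}:i<\kappa\rangle$ and $J^{\rm bd}_\kappa$; * ${}^{\mu_i^+}M_{\alpha i}\subseteq M_{\alpha i}$ for all $\alpha<\mu^+$ and $i<\kappa$; * $\alpha\subseteq\bigcup_{i<\kappa}M_{\alpha i}$ for every $\alpha<\mu^+$; * if every $\lambda_i$ is regular and ${\rm tcf}(\prod_{i<\kappa}\lambda_i,J^{\rm bd}_\kappa)$ exists and is greater than $\mu^+$, then $\mathcal M$ is a $\mu^+\times\kappa$ pcf array based on $\langle\lambda_{h(i)}:i<\kappa\rangle$ and $J^{\rm bd}_\kappa$. -/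

import Mathlib

universe u

open Cardinal
open scoped FirstOrder

namespace PcfArray

/-- The set `H(χ)` of all sets whose transitive closure has fewer than `χ` elements. A set is
in `H(χ)` iff it is included in some transitive set of cardinality less than `χ`
(the transitive closure being the least transitive set that includes it). -/
def HSet (χ : Cardinal.{u}) : Type (u + 1) :=
  {x : ZFSet.{u} // ∃ t : ZFSet.{u}, t.IsTransitive ∧ x ⊆ t ∧ t.card < χ}

/-- A finite family of additional predicates (relations of finite arity) on a set `A`. -/
structure Predicates (A : Type*) where
  /-- the number of predicates -/
  num : ℕ
  /-- their arities -/
  arity : Fin num → ℕ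
  /-- the predicates themselves -/
  holds : ∀ k : Fin num, (Fin (arity k) → A) → Prop

/-- The relation symbols: a binary membership symbol and one symbol for each extra predicate. -/
inductive RelSymb {num : ℕ} (arity : Fin num → ℕ) : ℕ → Type
  | mem : RelSymb arity 2
  | pred (k : Fin num) : RelSymb arity (arity k)

/-- The language of set theory, augmented by finitely many predicate symbols. -/
def Predicates.language {A : Type*} (P : Predicates A) : FirstOrder.Language.{0, 0} where
  Functions := fun _ => Empty
  Relations := RelSymb P.arity

/-- The universe of the structure `(H(χ), ∈, P)`. -/
def Predicates.Model {χ : Cardinal.{u}} (_P : Predicates (HSet χ)) : Type (u + 1) := HSet χ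

/-- The structure `(H(χ), ∈, P)`. -/
instance Predicates.structureModel {χ : Cardinal.{u}} (P : Predicates (HSet χ)) :
    P.language.Structure P.Model where
  funMap := fun f => nomatch f
  RelMap := fun r x =>
    match r, x with
    | RelSymb.mem, x => (x 0).val ∈ (x 1).val
    | RelSymb.pred k, x => P.holds k x

/-- The sets that belong to an elementary submodel of `(H(χ), ∈, P)`. -/
def elems {χ : Cardinal.{u}} {P : Predicates (HSet χ)}
    (M : P.language.ElementarySubstructure P.Model) : Set ZFSet.{u} :=
  {x | ∃ m : P.Model, m ∈ M ∧ m.val = x}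

/-- `M ≺ N`: `M` is included in `N`, and the inclusion is an elementary embedding. -/
def IsElemSub {L : FirstOrder.Language} {A : Type*} [L.Structure A] (M N : L.ElementarySubstructure A) :
    Prop :=
  ∃ f : M ↪ₑ[L] N, ∀ x : M, (f x : A) = x

/-- `^θ M ⊆ M`: each function from (the von Neumann cardinal) `θ` to `M` is an element
of `M`. -/
def ClosedUnderSeq {χ : Cardinal.{u}} {P : Predicates (HSet χ)} (θ : Cardinal.{u})
    (M : P.language.ElementarySubstructure P.Model) : Prop :=
  ∀ y f : ZFSet.{u}, (∀ w ∈ y, w ∈ elems M) → ZFSet.IsFunc θ.ord.toZFSet y f → f ∈ elems M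

/-- The ideal of bounded subsets of `κ`, as a family of sets. -/
def Jbd (κ : Cardinal.{u}) : Set (Set (Set.Iio κ.ord)) :=
  {s | BddAbove s}

/-- `f <_J g` for `f`, `g` in the product of the `lam i`, `i < κ`. -/
def LtMod {κ : Cardinal.{u}} {lam : Set.Iio κ.ord → Cardinal.{u}}
    (J : Set (Set (Set.Iio κ.ord))) (f g : ∀ i, Set.Iio (lam i).ord) : Prop :=
  {i | (g i : Ordinal.{u}) ≤ f i} ∈ J

/-- `tcf (∏ i < κ, lam i, J) = θ`: there is a `<_J`-increasing cofinal sequence, and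
`θ` is the least length of such a sequence. -/
def HasTcf {κ : Cardinal.{u}} (lam : Set.Iio κ.ord → Cardinal.{u})
    (J : Set (Set (Set.Iio κ.ord))) (θ : Cardinal.{u}) : Prop :=
  IsLeast {o : Ordinal.{u} | ∃ f : Set.Iio o → ∀ i, Set.Iio (lam i).ord,
    (∀ a b, a < b → LtMod J (f a) (f b)) ∧ ∀ g, ∃ a, LtMod J g (f a)} θ.ord

/-- The three clauses on a `len × κ` matrix of elementary submodels of `(H(χ), ∈, P)`
in the definition of a pcf array based on `lam` and `J`. -/
structure IsArrayOn {χ κ len : Cardinal.{u}} {P : Predicates (HSet χ)}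
    (M : Set.Iio len.ord → Set.Iio κ.ord → P.language.ElementarySubstructure P.Model)
    (lam : Set.Iio κ.ord → Cardinal.{u}) (J : Set (Set (Set.Iio κ.ord))) : Prop where
  row : ∀ α, ∀ i j, i < j → IsElemSub (M α i) (M α j)
  column : ∀ α β, α < β → ∃ u ∈ J, ∀ j, j ∉ u → IsElemSub (M α j) (M β j)
  card_lt : ∀ α i, #(M α i) < Cardinal.lift.{u + 1} (lam i)

/-- A `len × κ` pcf array of elementary submodels of `(H(χ), ∈, P)`, based on `lam` and `J`:
the standing assumptions on `μ`, `κ`, `χ`, `len`, `lam`, `J`, and the three clauses. -/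
structure IsPcfArray {χ κ len : Cardinal.{u}} {P : Predicates (HSet χ)} (μ : Cardinal.{u})
    (M : Set.Iio len.ord → Set.Iio κ.ord → P.language.ElementarySubstructure P.Model)
    (lam : Set.Iio κ.ord → Cardinal.{u}) (J : Set (Set (Set.Iio κ.ord))) : Prop
    extends IsArrayOn M lam J where
  singular : μ.IsSingular
  cof_eq : μ.ord.cof = κ
  regular : χ.IsRegular
  two_power_lt : 2 ^ μ < χ
  regular_lam : ∀ i, (lam i).IsRegular
  strictMono_lam : StrictMono lam
  isLUB_lam : IsLUB (Set.range lam) μ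
  isIdeal : Order.IsIdeal J
  proper : Set.univ ∉ J
  bounded_mem : Jbd κ ⊆ J
  lt_len : μ < len
  lt_tcf : ∃ θ, HasTcf lam J θ ∧ len < θ

end PcfArray

namespace PcfArray

-- An injection of `α < μ⁺` into `μ` writes `α` as an increasing union of sets `A α i` of size at
-- most `μ_i`. By recursion on `α`, the entry `M α i` is the least set that contains the ordinals in
-- `A α i`, includes `M β i` for each `β ∈ A α i`, and is closed under Skolem functions and under
-- subsets of size at most `θ = μ_i⁺`. Since `(2 ^ θ) ^ θ = 2 ^ θ`, its size is at most `2 ^ θ <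
-- λ_{h(i)}` (`mk_hull_le`, `mk_rows_le`).
--
-- Hulls grow with `θ` and with the generators, so rows increase. If `α < β`, then `α` enters `A β
-- i` at some `i`, and `M α j ⊆ M β j` for all `j ≥ i`, so the exceptional indices are bounded.
-- Inclusion suffices for `≺`, both sets being elementary in the same structure. A function from `θ`
-- to `M α i` is a set of at most `θ` pairs from `M α i`, hence an element of it.
--
-- For the pcf clause, a scale restricted along `h` is still a scale; its length equals its own
-- cofinality, so no scale of the subsequence is shorter (`HasTcf.comp`).

universe v

/-! ### Generating sets by operations of infinite arity -/

/-- `S` is closed under each of the `ι`-ary operations `op k`. -/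
def IsOpClosed {A K ι : Type*} (op : K → (ι → A) → A) (S : Set A) : Prop :=
  ∀ k g, (∀ i, g i ∈ S) → op k g ∈ S

/-- The stages of the generation of a set from `X` by the operations `op k`. -/
def opStage {A K ι W : Type*} [LinearOrder W] [WellFoundedLT W] (op : K → (ι → A) → A)
    (X : Set A) : W → Set A :=
  WellFoundedLT.fix fun w rec =>
    X ∪ {y | ∃ k g, (∀ i : ι, ∃ (w' : W) (h : w' < w), g i ∈ rec w' h) ∧ op k g = y}

theorem opStage_eq {A K ι W : Type*} [LinearOrder W] [WellFoundedLT W] (op : K → (ι → A) → A)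
    (X : Set A) (w : W) :
    opStage op X w =
      X ∪ {y | ∃ k g, (∀ i : ι, ∃ w' < w, g i ∈ opStage op X w') ∧ op k g = y} := by
  rw [opStage, WellFoundedLT.fix_eq]
  simp only [exists_prop]

theorem mk_iUnion_le_of_le {A W : Type v} (f : W → Set A) {c : Cardinal.{v}} (hc : ℵ₀ ≤ c)
    (hW : #W ≤ c) (hf : ∀ w, #(f w) ≤ c) : #(⋃ w, f w) ≤ c := by
  have h : ⨆ w, #(f w) ≤ c := ciSup_le' hf
  calc #(⋃ w, f w) ≤ #W * ⨆ w, #(f w) := mk_iUnion_le f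
    _ ≤ c * c := mul_le_mul' hW h
    _ = c := mul_eq_self hc

theorem mk_opStage_le {A K ι W : Type v} [LinearOrder W] [WellFoundedLT W]
    (op : K → (ι → A) → A) (X : Set A) {c : Cardinal.{v}} (hc : ℵ₀ ≤ c) (hcι : c ^ #ι = c)
    (hK : #K ≤ c) (hX : #X ≤ c) (hW : #W ≤ c) (w : W) : #(opStage op X w) ≤ c := by
  induction w using WellFoundedLT.induction with
  | ind w ih =>
    rw [opStage_eq]
    refine (mk_union_le _ _).trans (add_le_of_le hc hX ?_)
    set U : Set A := ⋃ w' : Set.Iio w, opStage op X w'.1 with hU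
    have hUc : #U ≤ c :=
      mk_iUnion_le_of_le _ hc ((mk_subtype_le _).trans hW) fun w' => ih w'.1 w'.2
    have hsub : {y | ∃ k g, (∀ i : ι, ∃ w' < w, g i ∈ opStage op X w') ∧ op k g = y} ⊆
        Set.range fun p : K × (ι → U) => op p.1 fun i => (p.2 i : A) := by
      rintro y ⟨k, g, hg, rfl⟩
      refine ⟨(k, fun i => ⟨g i, ?_⟩), rfl⟩
      obtain ⟨w', hw', h⟩ := hg i
      exact Set.mem_iUnion.2 ⟨⟨w', hw'⟩, h⟩
    calc #_ ≤ #(K × (ι → U)) := (mk_le_mk_of_subset hsub).trans mk_range_le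
      _ = #K * #U ^ #ι := by rw [mk_prod, lift_id, lift_id, power_def]
      _ ≤ c * c ^ #ι := mul_le_mul' hK (power_le_power_right hUc)
      _ = c := by rw [hcι, mul_eq_self hc]

theorem exists_isOpClosed_superset {A K ι : Type v} (op : K → (ι → A) → A) (X : Set A)
    {c : Cardinal.{v}} (hι : ℵ₀ ≤ #ι) (hιc : #ι < c) (hcι : c ^ #ι = c) (hK : #K ≤ c)
    (hX : #X ≤ c) : ∃ S, X ⊆ S ∧ IsOpClosed op S ∧ #S ≤ c := by
  have hreg : (Order.succ #ι).IsRegular := isRegular_succ hι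
  have hc : ℵ₀ ≤ c := hι.trans hιc.le
  let W := (Order.succ #ι).ord.ToType
  have hWc : #W = Order.succ #ι := mk_ord_toType _
  have hW : #W ≤ c := hWc.le.trans (Order.succ_le_of_lt hιc)
  have hcof : Order.cof W = Order.succ #ι := by rw [Ordinal.cof_toType, hreg.cof_ord]
  have hWne : Nonempty W := mk_ne_zero_iff.1 (hWc.trans_ne hreg.ne_zero)
  refine ⟨⋃ w : W, opStage op X w, ?_, ?_, ?_⟩
  · intro x hx
    refine Set.mem_iUnion.2 ⟨Classical.arbitrary W, ?_⟩
    rw [opStage_eq]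
    exact Or.inl hx
  · intro k g hg
    choose w hw using fun i => Set.mem_iUnion.1 (hg i)
    -- The number of stages is the regular cardinal `(#ι)⁺`, so the stages of `#ι` many arguments
    -- are bounded by a later stage, where the value of the operation appears.
    have hnot : ¬ IsCofinal (Set.range w) := fun h =>
      ((hcof.symm.le.trans (Order.cof_le h)).trans mk_range_le).not_gt (Order.lt_succ _)
    obtain ⟨b, hb⟩ := not_isCofinal_iff.1 hnot
    refine Set.mem_iUnion.2 ⟨b, ?_⟩
    rw [opStage_eq]
    exact Or.inr ⟨k, g, fun i => ⟨w i, hb _ ⟨i, rfl⟩, hw i⟩, rfl⟩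
  · exact mk_iUnion_le_of_le _ hc hW fun w => mk_opStage_le op X hc hcι hK hX hW w

/-! ### Sets closed under small subsets in `H(χ)` -/

variable {χ : Cardinal.{u}}

/-- `x` belongs to `H(χ)`. -/
def InHSet (χ : Cardinal.{u}) (x : ZFSet.{u}) : Prop :=
  ∃ t : ZFSet.{u}, t.IsTransitive ∧ x ⊆ t ∧ t.card < χ

/-- The union of `y` with transitive witnesses for its elements is transitive, and regularity of `χ`
keeps it small. -/
theorem InHSet.of_forall_mem (hχ : χ.IsRegular) {y : ZFSet.{u}} (hy : y.card < χ)
    (h : ∀ z ∈ y, InHSet χ z) : InHSet χ y := by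
  have h' : ∀ a : Shrink.{u} y, InHSet χ ((equivShrink y).symm a).1 :=
    fun a => h _ ((equivShrink y).symm a).2
  choose t ht hsub hcard using h'
  have hU : (ZFSet.iUnion t).card < χ := by
    have h1 := ZFSet.lift_card_iUnion_le_sum_card (f := t)
    rw [lift_id] at h1
    exact h1.trans_lt (sum_lt_of_isRegular hχ hy hcard)
  refine ⟨y ∪ ZFSet.iUnion t, ?_, fun z hz => ZFSet.mem_union.2 (Or.inl hz),
    ZFSet.card_union_le.trans_lt (add_lt_of_lt hχ.aleph0_le hy hU)⟩
  intro z hz w hw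
  refine ZFSet.mem_union.2 (Or.inr (ZFSet.mem_iUnion.2 ?_))
  rcases ZFSet.mem_union.1 hz with hz | hz
  · refine ⟨equivShrink y ⟨z, hz⟩, hsub _ ?_⟩
    simpa using hw
  · obtain ⟨a, ha⟩ := ZFSet.mem_iUnion.1 hz
    exact ⟨a, (ht a).mem_trans hw ha⟩

theorem InHSet.toZFSet {ξ : Ordinal.{u}} (hξ : ξ.card < χ) : InHSet χ ξ.toZFSet :=
  ⟨ξ.toZFSet, (ZFSet.isOrdinal_toZFSet ξ).isTransitive, fun _ h => h, by
    rwa [Ordinal.card_toZFSet]⟩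

/-- `S` contains each of its subsets of size at most `θ` that belong to `H(χ)`. -/
def IsSubsetClosed (θ : Cardinal.{u}) (S : Set (HSet χ)) : Prop :=
  ∀ y : HSet χ, y.val.card ≤ θ → (∀ z ∈ y.val, ∃ m ∈ S, m.val = z) → y ∈ S

theorem IsSubsetClosed.mono {θ θ' : Cardinal.{u}} (h : θ ≤ θ') {S : Set (HSet χ)}
    (hS : IsSubsetClosed θ' S) : IsSubsetClosed θ S :=
  fun y hy => hS y (hy.trans h)

namespace IsSubsetClosed

variable {θ : Cardinal.{u}} {S : Set (HSet χ)}

theorem val_mem (hχ : χ.IsRegular) (hθχ : θ < χ) (hS : IsSubsetClosed θ S) {y : ZFSet.{u}}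
    (hy : y.card ≤ θ) (h : ∀ z ∈ y, z ∈ Subtype.val '' S) : y ∈ Subtype.val '' S := by
  have hyH : InHSet χ y := .of_forall_mem hχ (hy.trans_lt hθχ) fun z hz => by
    obtain ⟨m, -, rfl⟩ := h z hz
    exact m.2
  exact ⟨⟨y, hyH⟩, hS ⟨y, hyH⟩ hy h, rfl⟩

theorem pair_mem (hχ : χ.IsRegular) (hθχ : θ < χ) (hθ : ℵ₀ ≤ θ) (hS : IsSubsetClosed θ S)
    {a b : ZFSet.{u}} (ha : a ∈ Subtype.val '' S) (hb : b ∈ Subtype.val '' S) :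
    ZFSet.pair a b ∈ Subtype.val '' S := by
  have key : ∀ {a b : ZFSet.{u}}, a ∈ Subtype.val '' S → b ∈ Subtype.val '' S →
      ({a, b} : ZFSet) ∈ Subtype.val '' S := by
    intro a b ha hb
    refine hS.val_mem hχ hθχ (ZFSet.card_insert_le.trans ?_) fun z hz => ?_
    · rw [ZFSet.card_singleton, one_add_one_eq_two]
      exact (natCast_lt_aleph0 (n := 2)).le.trans hθ
    · rcases ZFSet.mem_pair.1 hz with rfl | rfl <;> assumption
  refine key ?_ (key ha hb)
  have h := key ha ha
  rwa [ZFSet.pair_eq_singleton] at h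

theorem toZFSet_mem (hχ : χ.IsRegular) (hθχ : θ < χ) (hS : IsSubsetClosed θ S)
    {ξ : Ordinal.{u}} (hξ : ξ ≤ θ.ord) : ξ.toZFSet ∈ Subtype.val '' S := by
  induction ξ using WellFoundedLT.induction with
  | ind ξ ih =>
    refine hS.val_mem hχ hθχ ?_ fun z hz => ?_
    · rw [Ordinal.card_toZFSet]
      simpa using Ordinal.card_le_card hξ
    · obtain ⟨a, ha, rfl⟩ := Ordinal.mem_toZFSet_iff.1 hz
      exact ih a ha (ha.le.trans hξ)

theorem func_mem (hχ : χ.IsRegular) (hθχ : θ < χ) (hθ : ℵ₀ ≤ θ) (hS : IsSubsetClosed θ S)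
    {y f : ZFSet.{u}} (hy : ∀ w ∈ y, w ∈ Subtype.val '' S)
    (hf : ZFSet.IsFunc θ.ord.toZFSet y f) : f ∈ Subtype.val '' S := by
  have hsub : ∀ p ∈ f, ∃ a ∈ θ.ord.toZFSet, ∃ b ∈ y, p = ZFSet.pair a b :=
    fun p hp => ZFSet.mem_prod.1 (hf.1 hp)
  refine hS.val_mem hχ hθχ ?_ fun p hp => ?_
  · have hinj : #f ≤ #θ.ord.toZFSet := by
      choose a ha b hb hab using fun p : f => hsub p.1 p.2
      refine mk_le_of_injective (f := fun p => (⟨a p, ha p⟩ : θ.ord.toZFSet)) fun p q hpq => ?_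
      have hpq : a p = a q := congrArg Subtype.val hpq
      have hp := p.2
      have hq := q.2
      rw [hab p] at hp
      rw [hab q, ← hpq] at hq
      have := (hf.2 (a p) (ha p)).unique hp hq
      exact Subtype.ext (by rw [hab p, hab q, hpq, this])
    rw [ZFSet.cardinalMk_coe_sort, ZFSet.cardinalMk_coe_sort, lift_le, Ordinal.card_toZFSet] at hinj
    simpa using hinj
  · obtain ⟨a, ha, b, hb, rfl⟩ := hsub p hp
    refine hS.pair_mem hχ hθχ hθ ?_ (hy b hb)
    obtain ⟨ξ, hξ, rfl⟩ := Ordinal.mem_toZFSet_iff.1 ha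
    exact hS.toZFSet_mem hχ hθχ hξ.le

end IsSubsetClosed

/-! ### Skolem hulls and their size -/

/-- `S` is closed under the Skolem functions of the structure. -/
def IsSkolemClosed {L : FirstOrder.Language.{0, 0}} {A : Type*} [Nonempty A] [L.Structure A]
    (S : Set A) : Prop :=
  ∀ n (f : (L.sum L.skolem₁).Functions n) (x : Fin n → A), (∀ i, x i ∈ S) →
    FirstOrder.Language.Structure.funMap f x ∈ S

/-- The elementary substructure on a set that is closed under the Skolem functions. -/
noncomputable def IsSkolemClosed.toElementarySubstructure {L : FirstOrder.Language.{0, 0}}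
    {A : Type*} [Nonempty A] [L.Structure A] {S : Set A} (hS : IsSkolemClosed (L := L) S) :
    L.ElementarySubstructure A :=
  FirstOrder.Language.Substructure.elementarySkolem₁Reduct
    { carrier := S, fun_mem := fun {n} f x hx => hS n f x hx }

theorem isElemSub_of_le {L : FirstOrder.Language} {A : Type*} [L.Structure A]
    {M N : L.ElementarySubstructure A} (h : M ≤ N) : IsElemSub M N := by
  refine ⟨⟨fun x => ⟨x.1, h x.2⟩, fun n φ x => ?_⟩, fun x => rfl⟩
  rw [← N.subtype.map_formula φ, ← M.subtype.map_formula φ]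
  rfl

theorem mk_skolem_functions_le {A : Type*} (P : Predicates A) :
    #(Σ n, (P.language.sum P.language.skolem₁).Functions n) ≤ ℵ₀ := by
  refine FirstOrder.Language.card_functions_sum_skolem₁_le.trans (max_le le_rfl ?_)
  have h : Function.Injective fun r : P.language.Symbols =>
      (match r with
      | Sum.inl ⟨_, f⟩ => nomatch f
      | Sum.inr ⟨_, RelSymb.mem⟩ => none
      | Sum.inr ⟨_, RelSymb.pred k⟩ => some k : Option (Fin P.num)) := by
    rintro (⟨n, ⟨⟩⟩ | ⟨n, r⟩) (⟨m, ⟨⟩⟩ | ⟨m, s⟩) hrs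
    cases r <;> cases s <;> simp only [reduceCtorEq, Option.some.injEq] at hrs
    · rfl
    · subst hrs
      rfl
  exact (mk_le_of_injective h).trans mk_le_aleph0

/-- The least set that includes `X` and is closed under the Skolem functions and under subsets of
size at most `θ`. -/
def hull (P : Predicates (HSet χ)) [Nonempty P.Model] (θ : Cardinal.{u}) (X : Set (HSet χ)) :
    Set (HSet χ) :=
  {a | ∀ S : Set (HSet χ), X ⊆ S → IsSkolemClosed (L := P.language) (A := P.Model) S →
    IsSubsetClosed θ S → a ∈ S}

section hull

variable (P : Predicates (HSet χ)) [Nonempty P.Model] (θ : Cardinal.{u}) (X : Set (HSet χ))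

theorem subset_hull : X ⊆ hull P θ X := fun _ ha _ hS _ _ => hS ha

theorem isSkolemClosed_hull : IsSkolemClosed (L := P.language) (A := P.Model) (hull P θ X) :=
  fun n f x hx S hXS hS hS' => hS n f x fun i => hx i S hXS hS hS'

theorem isSubsetClosed_hull : IsSubsetClosed θ (hull P θ X) := by
  intro y hy h S hXS hS hS'
  refine hS' y hy fun z hz => ?_
  obtain ⟨m, hm, rfl⟩ := h z hz
  exact ⟨m, hm S hXS hS hS', rfl⟩

variable {θ X}

theorem hull_mono {θ' : Cardinal.{u}} {X' : Set (HSet χ)} (hθ : θ ≤ θ') (hX : X ⊆ X') :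
    hull P θ X ⊆ hull P θ' X' :=
  fun _ ha S hXS hS hS' => ha S (hX.trans hXS) hS (hS'.mono hθ)

/-- Both closure conditions are coded by countably many operations of the single arity `θ`, so
`exists_isOpClosed_superset` gives a closed set of size at most `2 ^ θ` that includes the hull. -/
theorem mk_hull_le (hθ : ℵ₀ ≤ θ) (hX : #X ≤ Cardinal.lift.{u + 1} (2 ^ θ)) :
    #(hull P θ X) ≤ Cardinal.lift.{u + 1} (2 ^ θ) := by
  classical
  let ι := Set.Iio θ.ord
  have hι : #ι = Cardinal.lift.{u + 1} θ := by
    rw [Cardinal.mk_Iio_ordinal, card_ord]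
  have hι0 : ℵ₀ ≤ #ι := by rw [hι]; simpa using hθ
  have : Infinite ι := infinite_iff.2 hι0
  let e : ℕ ↪ ι := Infinite.natEmbedding ι
  set c := Cardinal.lift.{u + 1} (2 ^ θ) with hc
  have hιc : #ι < c := by rw [hι, hc, lift_lt]; exact cantor θ
  have hpow : c ^ #ι = c := by
    rw [hι, hc, ← lift_power, ← power_mul, mul_eq_self hθ]
  have hc0 : ℵ₀ ≤ c := hι0.trans hιc.le
  let d : HSet χ := (Classical.arbitrary P.Model : P.Model)
  let F := Σ n, (P.language.sum P.language.skolem₁).Functions n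
  -- The empty set is not the range of a `θ`-sequence, so it joins the generators.
  let Em : Set (HSet χ) := {y | y.val = ∅}
  -- `none` collects the range of `g` into a set, with a default in the closed set when that range
  -- is not in `H(χ)`; `some f` applies a Skolem function to the coordinates picked by `e`.
  let op : Option (ULift.{u + 1} F) → (ι → HSet χ) → HSet χ := fun k g =>
    match k with
    | none => if h : ∃ y : HSet χ, ∀ z, z ∈ y.val ↔ ∃ i, (g i).val = z then h.choose else g (e 0)
    | some f => FirstOrder.Language.Structure.funMap (M := P.Model) f.down.2 fun i => g (e i)
  have hEm : #Em ≤ 1 := by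
    rw [mk_le_one_iff_set_subsingleton]
    exact fun a ha b hb => Subtype.ext (ha.trans hb.symm)
  obtain ⟨S, hXS, hS, hSc⟩ := exists_isOpClosed_superset op (insert d (X ∪ Em)) hι0 hιc hpow
    (by
      rw [mk_option, mk_uLift]
      refine add_le_of_le hc0 ?_ (one_le_aleph0.trans hc0)
      have := lift_le.{u + 1}.2 (mk_skolem_functions_le P)
      rw [lift_aleph0] at this
      exact this.trans hc0)
    (mk_insert_le.trans (add_le_of_le hc0 ((mk_union_le _ _).trans
      (add_le_of_le hc0 hX (hEm.trans (one_le_aleph0.trans hc0)))) (one_le_aleph0.trans hc0)))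
  suffices hsub : hull P θ X ⊆ S from (mk_le_mk_of_subset hsub).trans hSc
  refine fun a ha => ha S ?_ ?_ ?_
  · exact fun x hx => hXS (Or.inr (Or.inl hx))
  · intro n f (x : Fin n → HSet χ) hx
    have hdS : d ∈ S := hXS (Or.inl rfl)
    -- The finite tuple is padded by `d`, which was put among the generators for this purpose.
    let g : ι → HSet χ := fun i => if h : ∃ k : Fin n, e k = i then x h.choose else d
    have hg : ∀ k : Fin n, g (e k) = x k := by
      intro k
      have h : ∃ k' : Fin n, e k' = e k := ⟨k, rfl⟩
      have h' : h.choose = k := Fin.ext (e.injective h.choose_spec)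
      simp only [g, dif_pos h, h']
    have hop := hS (some ⟨⟨n, f⟩⟩) g fun i => by
      by_cases h : ∃ k : Fin n, e k = i
      · simp only [g, dif_pos h]; exact hx _
      · simp only [g, dif_neg h]; exact hdS
    have hgx : (fun i : Fin n => g (e i)) = x := funext hg
    simp only [op] at hop
    rw [hgx] at hop
    exact hop
  · intro y hy h
    by_cases hne : Nonempty y.val
    · have hle : #y.val ≤ #ι := by
        rw [ZFSet.cardinalMk_coe_sort, hι, lift_le]; exact hy
      obtain ⟨j⟩ := Cardinal.le_def _ _ |>.1 hle
      have hs : Function.Surjective (Function.invFun j) := Function.invFun_surjective j.injective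
      choose m hmS hm using fun i : ι => h _ (Function.invFun j i).2
      have hex : ∃ y' : HSet χ, ∀ z, z ∈ y'.val ↔ ∃ i, (m i).val = z := by
        refine ⟨y, fun z => ⟨fun hz => ?_, ?_⟩⟩
        · obtain ⟨i, hi⟩ := hs ⟨z, hz⟩
          exact ⟨i, by rw [hm, hi]⟩
        · rintro ⟨i, rfl⟩
          rw [hm]
          exact (Function.invFun j i).2
      have hop := hS none m hmS
      simp only [op, dif_pos hex] at hop
      convert hop
      refine Subtype.ext (ZFSet.ext fun z => ?_)
      rw [hex.choose_spec z]
      constructor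
      · intro hz
        obtain ⟨i, hi⟩ := hs ⟨z, hz⟩
        exact ⟨i, by rw [hm, hi]⟩
      · rintro ⟨i, rfl⟩
        rw [hm]
        exact (Function.invFun j i).2
    · refine hXS (Or.inr (Or.inr ?_))
      refine (ZFSet.eq_empty _).2 fun z hz => hne ⟨⟨z, hz⟩⟩

end hull

/-! ### The bounded ideal and true cofinality of subsequences -/

theorem noMaxOrder_Iio_ord {κ : Cardinal.{u}} (hκ : ℵ₀ ≤ κ) : NoMaxOrder (Set.Iio κ.ord) where
  exists_gt x :=
    ⟨⟨Order.succ x.1, (isSuccLimit_ord hκ).succ_lt x.2⟩, Order.lt_succ x.1⟩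

theorem bddAbove_preimage_of_strictMono {κ : Cardinal.{u}} {h : Set.Iio κ.ord → Set.Iio κ.ord}
    (hh : StrictMono h) {s : Set (Set.Iio κ.ord)} (hs : BddAbove s) : BddAbove (h ⁻¹' s) := by
  obtain ⟨b, hb⟩ := hs
  exact ⟨b, fun i hi => hh.le_apply.trans (hb hi)⟩

theorem univ_notMem_Jbd {κ : Cardinal.{u}} (hκ : ℵ₀ ≤ κ) : Set.univ ∉ Jbd κ := by
  have := noMaxOrder_Iio_ord hκ
  rintro ⟨b, hb⟩
  obtain ⟨c, hc⟩ := exists_gt b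
  exact (hb (Set.mem_univ c)).not_gt hc

theorem isIdeal_Jbd {κ : Cardinal.{u}} (hκ : ℵ₀ ≤ κ) : Order.IsIdeal (Jbd κ) where
  IsLowerSet _ _ hst hs := BddAbove.mono hst hs
  Nonempty := by
    have hpos : 0 < κ.ord := (isSuccLimit_ord hκ).bot_lt
    exact ⟨∅, ⟨⟨0, hpos⟩, fun _ h => h.elim⟩⟩
  Directed s hs t ht := by
    refine ⟨s ∪ t, ?_, Set.subset_union_left, Set.subset_union_right⟩
    exact BddAbove.union hs ht

theorem LtMod.trans {κ : Cardinal.{u}} {lam : Set.Iio κ.ord → Cardinal.{u}}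
    {f g k : ∀ i, Set.Iio (lam i).ord} (h₁ : LtMod (Jbd κ) f g) (h₂ : LtMod (Jbd κ) g k) :
    LtMod (Jbd κ) f k := by
  obtain ⟨a, ha⟩ := h₁
  obtain ⟨b, hb⟩ := h₂
  refine ⟨max a b, fun i hi => ?_⟩
  rcases le_or_gt (g i : Ordinal.{u}) (f i) with h | h
  · exact le_max_of_le_left (ha h)
  · exact le_max_of_le_right (hb (le_trans (b := (f i : Ordinal.{u})) hi h.le))

theorem LtMod.irrefl {κ : Cardinal.{u}} (hκ : ℵ₀ ≤ κ) {lam : Set.Iio κ.ord → Cardinal.{u}}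
    (f : ∀ i, Set.Iio (lam i).ord) : ¬ LtMod (Jbd κ) f f := by
  intro h
  have hu : {i | (f i : Ordinal.{u}) ≤ f i} = Set.univ := Set.eq_univ_of_forall fun i => le_refl (f i).1
  rw [LtMod, hu] at h
  exact univ_notMem_Jbd hκ h

/-- Bounds the length of a scale `F` by the size of any cofinal family `G`: were the chosen indices
all below `a`, some `G b` above `F a` would give `F a < G b < F a`. -/
theorem isCofinal_range_of_increasing {X α β : Type*} [LinearOrder α]
    {r : X → X → Prop} (htrans : ∀ {x y z}, r x y → r y z → r x z) (hirrefl : ∀ x, ¬ r x x)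
    {F : α → X} (hF : ∀ a b, a < b → r (F a) (F b)) (hF' : ∀ x, ∃ a, r x (F a))
    {G : β → X} (hG' : ∀ x, ∃ b, r x (G b)) :
    IsCofinal (Set.range fun b => (hF' (G b)).choose) := by
  by_contra hcon
  obtain ⟨a, ha⟩ := not_isCofinal_iff.1 hcon
  obtain ⟨b, hb⟩ := hG' (F a)
  exact hirrefl _ (htrans hb (htrans (hF' (G b)).choose_spec (hF _ _ (ha _ ⟨b, rfl⟩))))

/-- The lengths of the `<_J`-increasing cofinal sequences in the product of the `lam i`. -/
def scaleLengths {κ : Cardinal.{u}} (lam : Set.Iio κ.ord → Cardinal.{u})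
    (J : Set (Set (Set.Iio κ.ord))) : Set Ordinal.{u} :=
  {o | ∃ f : Set.Iio o → ∀ i, Set.Iio (lam i).ord,
    (∀ a b, a < b → LtMod J (f a) (f b)) ∧ ∀ g, ∃ a, LtMod J g (f a)}

/-- A scale may be thinned to a cofinal set of indices of least order type; hence the least length
is its own cofinality. -/
theorem cof_ord_mem_scaleLengths {κ : Cardinal.{u}} {lam : Set.Iio κ.ord → Cardinal.{u}}
    {o : Ordinal.{u}} (ho : o ∈ scaleLengths lam (Jbd κ)) :
    o.cof.ord ∈ scaleLengths lam (Jbd κ) := by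
  obtain ⟨f, hf, hf'⟩ := ho
  obtain ⟨s, hs, hstype⟩ := Ordinal.exists_ord_cof_eq (Set.Iio o)
  have htype : Ordinal.type (α := Set.Iio o.cof.ord) (· < ·) =
      Ordinal.type (α := s) (· < ·) := by
    rw [hstype, Ordinal.cof_Iio, ← Ordinal.lift_cof, Ordinal.type_lt_Iio, lift_ord]
  obtain ⟨e⟩ := Ordinal.type_eq.1 htype
  have he : ∀ a b, a < b → e a < e b := fun a b hab => e.map_rel_iff.2 hab
  refine ⟨fun a => f (e a).1, fun a b hab => hf _ _ (he a b hab), fun g => ?_⟩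
  obtain ⟨a, ha⟩ := hf' g
  obtain ⟨b, hb, hab⟩ := hs a
  refine ⟨e.symm ⟨b, hb⟩, ?_⟩
  simp only [RelIso.apply_symm_apply]
  rcases hab.eq_or_lt with rfl | hab
  · exact ha
  · exact ha.trans (hf _ _ hab)

theorem comp_mem_scaleLengths {κ : Cardinal.{u}} {lam : Set.Iio κ.ord → Cardinal.{u}}
    (hlam : ∀ i, lam i ≠ 0) {h : Set.Iio κ.ord → Set.Iio κ.ord} (hh : StrictMono h)
    {o : Ordinal.{u}} {f : Set.Iio o → ∀ i, Set.Iio (lam i).ord}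
    (hf : ∀ a b, a < b → LtMod (Jbd κ) (f a) (f b)) (hf' : ∀ g, ∃ a, LtMod (Jbd κ) g (f a)) :
    (∀ a b, a < b → LtMod (lam := lam ∘ h) (Jbd κ) (fun i => f a (h i)) fun i => f b (h i)) ∧
      ∀ g, ∃ a, LtMod (lam := lam ∘ h) (Jbd κ) g fun i => f a (h i) := by
  classical
  refine ⟨fun a b hab => bddAbove_preimage_of_strictMono hh (hf a b hab), fun g => ?_⟩
  have hpos : ∀ i, 0 < (lam i).ord := fun i => by
    rw [pos_iff_ne_zero, Ne, ord_eq_zero]; exact hlam i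
  -- `g` is extended by `0` off the range of `h`, so that a member of the scale on the full product
  -- can dominate it.
  let g' : ∀ i, Set.Iio (lam i).ord := fun i =>
    ⟨if hi : ∃ j, h j = i then (g hi.choose : Ordinal.{u}) else 0, by
      split_ifs with hi
      · have := (g hi.choose).2
        simpa only [Function.comp_apply, hi.choose_spec] using! this
      · exact hpos i⟩
  have hg' : ∀ j, (g' (h j) : Ordinal.{u}) = g j := by
    intro j
    have hj : ∃ j', h j' = h j := ⟨j, rfl⟩
    have : hj.choose = j := hh.injective hj.choose_spec
    simp only [g', dif_pos hj]
    rw [this]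
  obtain ⟨a, ha⟩ := hf' g'
  refine ⟨a, (bddAbove_preimage_of_strictMono hh ha).mono fun i hi => ?_⟩
  change (f a (h i) : Ordinal.{u}) ≤ g' (h i)
  rw [hg']
  exact hi

theorem HasTcf.comp {κ : Cardinal.{u}} (hκ : ℵ₀ ≤ κ) {lam : Set.Iio κ.ord → Cardinal.{u}}
    (hlam : ∀ i, lam i ≠ 0) {h : Set.Iio κ.ord → Set.Iio κ.ord} (hh : StrictMono h)
    {θ : Cardinal.{u}} (H : HasTcf lam (Jbd κ) θ) : HasTcf (lam ∘ h) (Jbd κ) θ := by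
  have hle : θ.ord ≤ θ.ord.cof.ord := H.2 (cof_ord_mem_scaleLengths H.1)
  obtain ⟨f, hf, hf'⟩ := H.1
  obtain ⟨hF, hF'⟩ := comp_mem_scaleLengths hlam hh hf hf'
  refine ⟨⟨fun a i => f a (h i), hF, hF'⟩, ?_⟩
  rintro o ⟨G, -, hG'⟩
  have hcofinal := isCofinal_range_of_increasing (r := LtMod (lam := lam ∘ h) (Jbd κ))
    (fun h₁ h₂ => LtMod.trans h₁ h₂) (LtMod.irrefl hκ) hF hF' hG'
  have hcof : Order.cof (Set.Iio θ.ord) ≤ #(Set.Iio o) :=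
    (Order.cof_le hcofinal).trans mk_range_le
  rw [Ordinal.cof_Iio, ← Ordinal.lift_cof, Cardinal.mk_Iio_ordinal, lift_le] at hcof
  exact hle.trans ((ord_le_ord.2 hcof).trans (ord_card_le o))

/-! ### Index functions, filtrations and the recursive matrix -/

theorem exists_strictMono_ge {κ : Cardinal.{u}} (hκ : κ.IsRegular)
    (k : Set.Iio κ.ord → Set.Iio κ.ord) :
    ∃ h : Set.Iio κ.ord → Set.Iio κ.ord, StrictMono h ∧ ∀ i, k i ≤ h i := by
  have step : ∀ (i : Set.Iio κ.ord) (g : ∀ j, j < i → Set.Iio κ.ord),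
      ∃ b, (∀ j hj, g j hj < b) ∧ k i ≤ b := by
    intro i g
    -- Fewer than `κ` values have been chosen before `i`, so regularity bounds them.
    have hnot : ¬ IsCofinal (Set.range fun j : Set.Iio i => g j.1 j.2) := by
      intro hcof
      have h₁ : #(Set.Iio i) ≤ #(Set.Iio i.1) :=
        mk_le_of_injective (f := fun j => (⟨j.1.1, j.2⟩ : Set.Iio i.1)) fun a b hab =>
          Subtype.ext (Subtype.ext (Subtype.mk.inj hab))
      have h₂ := ((Order.cof_le hcof).trans mk_range_le).trans h₁
      rw [Ordinal.cof_Iio, ← Ordinal.lift_cof, hκ.cof_ord, Cardinal.mk_Iio_ordinal, lift_le] at h₂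
      exact h₂.not_gt (lt_ord.1 i.2)
    obtain ⟨b, hb⟩ := not_isCofinal_iff.1 hnot
    exact ⟨max b (k i), fun j hj => lt_max_of_lt_left (hb _ ⟨⟨j, hj⟩, rfl⟩), le_max_right _ _⟩
  choose F hF hFk using step
  let h : Set.Iio κ.ord → Set.Iio κ.ord := WellFoundedLT.fix F
  have hh : ∀ i, h i = F i fun j _ => h j := fun i => WellFoundedLT.fix_eq F i
  refine ⟨h, fun j i hji => ?_, fun i => ?_⟩
  · rw [hh i]
    exact hF i (fun j _ => h j) j hji
  · rw [hh i]
    exact hFk _ _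

theorem exists_filtration {I : Type*} [Preorder I] {μ : Cardinal.{u}} {mu : I → Cardinal.{u}}
    (hmono : Monotone mu) (hlub : IsLUB (Set.range mu) μ) (α : Ordinal.{u}) :
    ∃ A : I → Set Ordinal.{u}, Monotone A ∧ (∀ i, A i ⊆ Set.Iio α) ∧
      (∀ i, #(A i) ≤ Cardinal.lift.{u + 1} (mu i)) ∧
      (α < (Order.succ μ).ord → ∀ ξ < α, ∃ i, ξ ∈ A i) := by
  by_cases hα : α < (Order.succ μ).ord
  · have hcard : #(Set.Iio α) ≤ #(Set.Iio μ.ord) := by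
      rw [Cardinal.mk_Iio_ordinal, Cardinal.mk_Iio_ordinal, card_ord, lift_le]
      exact Order.lt_succ_iff.1 (lt_ord.1 hα)
    obtain ⟨e⟩ := (Cardinal.le_def _ _).1 hcard
    refine ⟨fun i => {ξ | ∃ h : ξ < α, (e ⟨ξ, h⟩ : Ordinal.{u}) < (mu i).ord}, ?_, ?_, ?_, ?_⟩
    · rintro i j hij ξ ⟨h, hξ⟩
      exact ⟨h, hξ.trans_le (ord_le_ord.2 (hmono hij))⟩
    · rintro i ξ ⟨h, -⟩
      exact h
    · intro i
      rw [← card_ord (mu i), ← Cardinal.mk_Iio_ordinal]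
      refine mk_le_of_injective
        (f := fun ξ => (⟨e ⟨ξ.1, ξ.2.1⟩, ξ.2.2⟩ : Set.Iio (mu i).ord)) fun a b hab => ?_
      exact Subtype.ext (Subtype.mk.inj (e.injective (Subtype.ext (Subtype.mk.inj hab))))
    · intro _ ξ hξ
      have h₁ : (e ⟨ξ, hξ⟩ : Ordinal.{u}).card < μ := lt_ord.1 (e ⟨ξ, hξ⟩).2
      obtain ⟨_, ⟨i, rfl⟩, hi⟩ := (lt_isLUB_iff hlub).1 h₁
      exact ⟨i, hξ, lt_ord.2 hi⟩
  -- Empty sets serve for `α ≥ μ⁺`, so that the recursion can run over all ordinals.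
  · exact ⟨fun _ => ∅, fun _ _ _ => le_rfl, fun _ _ h => h.elim, fun _ => by simp,
      fun h => absurd h hα⟩

section rows

variable {χ : Cardinal.{u}} {I : Type*} (P : Predicates (HSet χ)) [Nonempty P.Model]
  (θ : I → Cardinal.{u}) (A : Ordinal.{u} → I → Set Ordinal.{u})

/-- The generators of the `α, i` entry of the matrix, given the previous rows. -/
def rowGenerators (α : Ordinal.{u}) (i : I) (S : ∀ β < α, I → Set (HSet χ)) : Set (HSet χ) :=
  {y | ∃ ξ ∈ A α i, y.val = ξ.toZFSet} ∪ {y | ∃ β, ∃ h : β < α, β ∈ A α i ∧ y ∈ S β h i}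

/-- The underlying sets of the matrix of submodels: the `α, i` entry is the hull of the
ordinals in `A α i` and the `β, i` entries for `β` in `A α i`. -/
def rows : Ordinal.{u} → I → Set (HSet χ) :=
  WellFoundedLT.fix fun α S i => hull P (θ i) (rowGenerators A α i S)

theorem rows_eq (α : Ordinal.{u}) (i : I) :
    rows P θ A α i = hull P (θ i) (rowGenerators A α i fun β _ => rows P θ A β) := by
  rw [rows, WellFoundedLT.fix_eq]

theorem isSkolemClosed_rows (α : Ordinal.{u}) (i : I) :
    IsSkolemClosed (L := P.language) (A := P.Model) (rows P θ A α i) := by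
  rw [rows_eq]
  exact isSkolemClosed_hull P _ _

theorem isSubsetClosed_rows (α : Ordinal.{u}) (i : I) :
    IsSubsetClosed (θ i) (rows P θ A α i) := by
  rw [rows_eq]
  exact isSubsetClosed_hull P _ _

variable {θ A}

theorem rows_mono [Preorder I] (hθ : Monotone θ) (hA : ∀ α, Monotone (A α)) (α : Ordinal.{u}) :
    Monotone (rows P θ A α) := by
  intro i j hij
  induction α using WellFoundedLT.induction with
  | ind α ih =>
    rw [rows_eq, rows_eq]
    refine hull_mono P (hθ hij) ?_
    rintro y (⟨ξ, hξ, hy⟩ | ⟨β, hβ, hβA, hy⟩)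
    · exact Or.inl ⟨ξ, hA α hij hξ, hy⟩
    · exact Or.inr ⟨β, hβ, hA α hij hβA, ih β hβ hy⟩

theorem rows_subset_rows {α β : Ordinal.{u}} {i : I} (hβα : β < α) (h : β ∈ A α i) :
    rows P θ A β i ⊆ rows P θ A α i := by
  rw [rows_eq P θ A α]
  exact fun y hy => subset_hull P _ _ (Or.inr ⟨β, hβα, h, hy⟩)

theorem toZFSet_mem_rows {α ξ : Ordinal.{u}} {i : I} (h : ξ ∈ A α i) (hξ : ξ.card < χ) :
    ξ.toZFSet ∈ Subtype.val '' rows P θ A α i := by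
  rw [rows_eq]
  exact ⟨⟨ξ.toZFSet, InHSet.toZFSet hξ⟩, subset_hull P _ _ (Or.inl ⟨ξ, h, rfl⟩), rfl⟩

theorem mk_rows_le {i : I} (hθ : ℵ₀ ≤ θ i)
    (hA : ∀ α, #(A α i) ≤ Cardinal.lift.{u + 1} (2 ^ θ i)) (α : Ordinal.{u}) :
    #(rows P θ A α i) ≤ Cardinal.lift.{u + 1} (2 ^ θ i) := by
  have hc : ℵ₀ ≤ Cardinal.lift.{u + 1} (2 ^ θ i) :=
    aleph0_le_lift.2 (hθ.trans (cantor _).le)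
  induction α using WellFoundedLT.induction with
  | ind α ih =>
    rw [rows_eq]
    refine mk_hull_le P hθ ((mk_union_le _ _).trans (add_le_of_le hc ?_ ?_))
    · refine le_trans ?_ (hA α)
      choose ξ hξ hy using fun y : {y : HSet χ | ∃ ξ ∈ A α i, y.val = ξ.toZFSet} => y.2
      refine mk_le_of_injective (f := fun y => (⟨ξ y, hξ y⟩ : A α i)) fun y z hyz => ?_
      have hyz : ξ y = ξ z := congrArg Subtype.val hyz
      exact Subtype.ext (Subtype.ext (by rw [hy y, hy z, hyz]))
    · have hsub : {y | ∃ β, ∃ _ : β < α, β ∈ A α i ∧ y ∈ rows P θ A β i} ⊆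
          ⋃ β : {β // β ∈ A α i ∧ β < α}, rows P θ A β.1 i := by
        rintro y ⟨β, hβ, hβA, hy⟩
        exact Set.mem_iUnion.2 ⟨⟨β, hβA, hβ⟩, hy⟩
      refine (mk_le_mk_of_subset hsub).trans (mk_iUnion_le_of_le _ hc ?_ fun β => ih β.1 β.2.2)
      exact (mk_le_mk_of_subset (s := {β | β ∈ A α i ∧ β < α}) fun β hβ => hβ.1).trans (hA α)

end rows

end PcfArray

/-! ### The main theorem -/

open PcfArray in
theorem mainTheorem3 (μ κ χ : Cardinal.{u})
    (hμ : μ.IsStrongLimit) (hsing : μ.IsSingular) (hκ : μ.ord.cof = κ) (hκω : ℵ₀ < κ)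
    (hχ : χ.IsRegular) (hμχ : 2 ^ μ < χ)
    (P : PcfArray.Predicates (PcfArray.HSet χ))
    (mu : Set.Iio κ.ord → Cardinal.{u}) (hmu : Order.IsNormal mu)
    (hmu_lub : IsLUB (Set.range mu) μ) (hmu_gt : ∀ i, κ < mu i)
    (lam : Set.Iio κ.ord → Cardinal.{u}) (hlam : StrictMono lam)
    (hlam_lub : IsLUB (Set.range lam) μ) :
    (∃ h : Set.Iio κ.ord → Set.Iio κ.ord,
      StrictMono h ∧ ∀ i, 2 ^ Order.succ (mu i) < lam (h i)) ∧
    ∀ h : Set.Iio κ.ord → Set.Iio κ.ord, StrictMono h →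
      (∀ i, 2 ^ Order.succ (mu i) < lam (h i)) →
      ∃ M : Set.Iio (Order.succ μ).ord → Set.Iio κ.ord →
          P.language.ElementarySubstructure P.Model,
        PcfArray.IsArrayOn M (lam ∘ h) (PcfArray.Jbd κ) ∧
        (∀ α i, PcfArray.ClosedUnderSeq (Order.succ (mu i)) (M α i)) ∧
        (∀ α : Set.Iio (Order.succ μ).ord, ∀ ξ < (α : Ordinal.{u}),
          ∃ i, ξ.toZFSet ∈ PcfArray.elems (M α i)) ∧
        ((∀ i, (lam i).IsRegular) →
          (∃ θ, PcfArray.HasTcf lam (PcfArray.Jbd κ) θ ∧ Order.succ μ < θ) →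
          PcfArray.IsPcfArray μ M (lam ∘ h) (PcfArray.Jbd κ)) := by
  have hκreg : κ.IsRegular := ⟨hκω.le, by rw [← hκ, Ordinal.cof_ord_cof]⟩
  have := noMaxOrder_Iio_ord hκω.le
  have hmu_lt : ∀ i, Order.succ (mu i) < μ := fun i => by
    obtain ⟨j, hj⟩ := exists_gt i
    exact hμ.isSuccLimit.succ_lt ((hmu.strictMono hj).trans_le (hmu_lub.1 ⟨j, rfl⟩))
  have hmuχ : ∀ i, Order.succ (mu i) < χ := fun i =>
    (hmu_lt i).trans ((cantor μ).trans hμχ)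
  have hmu_inf : ∀ i, ℵ₀ ≤ Order.succ (mu i) := fun i =>
    (hκω.trans (hmu_gt i)).le.trans (Order.le_succ _)
  refine ⟨?_, fun h hh hlt => ?_⟩
  · have hk : ∀ i, ∃ k, 2 ^ Order.succ (mu i) < lam k := fun i => by
      -- Since `μ` is a strong limit, `2 ^ μ_i⁺ < μ`, so some `λ_k` exceeds it.
      obtain ⟨_, ⟨k, rfl⟩, hk⟩ :=
        (lt_isLUB_iff hlam_lub).1 (hμ.isStrongPrelimit (hmu_lt i))
      exact ⟨k, hk⟩
    choose k hk using hk
    obtain ⟨h, hh, hkh⟩ := exists_strictMono_ge hκreg k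
    exact ⟨h, hh, fun i => (hk i).trans_le (hlam.monotone (hkh i))⟩
  have : Nonempty P.Model :=
    ⟨(⟨∅, ∅, ZFSet.isTransitive_empty, fun _ h => h, by
      rw [ZFSet.card_empty]; exact hχ.pos⟩ : HSet χ)⟩
  choose A hAmono hAsub hAcard hAcover using exists_filtration hmu.strictMono.monotone hmu_lub
  let θ : Set.Iio κ.ord → Cardinal.{u} := fun i => Order.succ (mu i)
  have hθ : Monotone θ := fun i j hij => Order.succ_le_succ (hmu.strictMono.monotone hij)
  let M : Set.Iio (Order.succ μ).ord → Set.Iio κ.ord →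
      P.language.ElementarySubstructure P.Model := fun α i =>
    (isSkolemClosed_rows P θ A α i).toElementarySubstructure
  have hM : IsArrayOn M (lam ∘ h) (Jbd κ) := by
    refine ⟨fun α i j hij => isElemSub_of_le ?_, fun α β hαβ => ?_, fun α i => ?_⟩
    · exact rows_mono P hθ hAmono α.1 hij.le
    · obtain ⟨i, hi⟩ := hAcover β.1 β.2 α.1 hαβ
      -- Once `α` lies in `A β i`, it lies in `A β j` for all `j ≥ i`; only the indices below `i`
      -- are exceptional.
      refine ⟨Set.Iio i, ⟨i, fun _ hj => le_of_lt hj⟩, fun j hj => isElemSub_of_le ?_⟩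
      exact rows_subset_rows P hαβ (hAmono _ (not_lt.1 hj) hi)
    · refine lt_of_le_of_lt (mk_rows_le P (θ := θ) (hmu_inf i) (fun β => ?_) α.1)
        (lift_lt.2 (hlt i))
      exact (hAcard β i).trans (lift_le.2 ((Order.le_succ _).trans (cantor _).le))
  refine ⟨M, hM, fun α i y f hy hf => ?_, fun α ξ hξ => ?_, fun hreg htcf => ?_⟩
  · exact (isSubsetClosed_rows P θ A α.1 i).func_mem hχ (hmuχ i) (hmu_inf i) hy hf
  · obtain ⟨i, hi⟩ := hAcover α.1 α.2 ξ hξ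
    refine ⟨i, toZFSet_mem_rows P hi ?_⟩
    have hξμ : ξ.card ≤ μ := Order.lt_succ_iff.1 (lt_ord.1 (hξ.trans α.2))
    exact hξμ.trans_lt ((cantor μ).trans hμχ)
  · obtain ⟨θ', hθ', hlt'⟩ := htcf
    exact
      { toIsArrayOn := hM
        singular := hsing
        cof_eq := hκ
        regular := hχ
        two_power_lt := hμχ
        regular_lam := fun i => hreg _
        strictMono_lam := hlam.comp hh
        isLUB_lam := by
          refine ⟨?_, fun b hb => hlam_lub.2 ?_⟩
          · rintro _ ⟨i, rfl⟩
            exact hlam_lub.1 ⟨h i, rfl⟩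
          · rintro _ ⟨i, rfl⟩
            -- Strict monotonicity gives `i ≤ h i`, so the subsequence has the same supremum.
            exact (hlam.monotone hh.le_apply).trans (hb ⟨i, rfl⟩)
        isIdeal := isIdeal_Jbd hκω.le
        proper := univ_notMem_Jbd hκω.le
        bounded_mem := le_rfl
        lt_len := Order.lt_succ μ
        lt_tcf := ⟨θ', hθ'.comp hκω.le (fun i => (hreg i).ne_zero) hh, hlt'⟩ }
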